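/- Let $\ell>1$ be an integer and let $R$ be a finite commutative local ring whose maximal ideal $\mathfrak m=Rp$ is principal of nilpotency degree $\ell$ (that is, $p^{\ell}=0\neq p^{\ell-1}$) and whose residue field has odd characteristic. Let $$A=R[X]/(X^2-p,\;X^{2\ell-1})=R\oplus R\pi,\qquad \pi=\text{the image of }X,$$ and let $*$ be the involution of $A$ that fixes every element of $R$ and sends $\pi$ to $-\pi$. Put $N=\{a\in A^\times \mid aa^*=1\}$ and let $\mathfrak n=Rp^{\ell-1}$ be the minimal ideal of $R$. Let $V$ be a nonzero free $A$-module of finite rank, and let $h:V\times V\to A$ be a nondegenerate skew hermitian form: $h$ is $*$-linear in the first variable, linear in the second, $h(v,u)=-h(u,v)^*$, and $u\mapsto h(u,-)$ is injective. Let $\mathrm U=\mathrm U(V,h)$ be its unitary group, in which $N$ is regarded as a central subgroup via $a\mapsto a\cdot 1_V$. Let $f:V\times V\to R$, $f(u,v)=\tfrac12\bigl(h(u,v)+h(u,v)^*\bigr)$, be the associated alternating $R$-bilinear form and $\mathrm{Sp}=\mathrm{Sp}(V,f)\subseteq \mathrm{GL}_R(V)$ its symplectic group, so that $N\subseteq \mathrm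 U\subseteq \mathrm{Sp}$. Let $H=R\times V$ be the Heisenberg group, with multiplication $(r,u)(s,v)=(r+s+f(u,v),\,u+v)$, on which $\mathrm{Sp}$ acts by ${}^g(r,u)=(r,gu)$. Let $\lambda:R^+\to\mathbb C^\times$ be a primitive linear character, that is, one whose kernel contains no nonzero ideal of $R$. Let $S:H\to \mathrm{GL}(X)$ be a finite dimensional irreducible complex representation such that $S(r,0)=\lambda(r)\,1_X$ for all $r\in R$. Let $G$ be a subgroup of $\mathrm{Sp}$ containing $N$ (for example $G=\mathrm{Sp}$ or $G=\mathrm U$), and let $W:G\to\mathrm{GL}(X)$ be a Weil representation of $G$, that is, a representation such that $W(g)S(k)W(g)^{-1}=S({}^gk)$ for all $g\in G$ and $k\in H$. The subspace $$\mathrm{Bot}=\{x\in X \mid S(0,u)x=x\ \text{ for all } u\in \mathfrak nV\}$$ is $G$-invariant, so that $G$, and hence $N$, acts on $\mathrm{Top}=X/\mathrm{Bot}$ through $W$. Then for every linear character $\phi:N\to\mathbb C^\times$ the eigenspace $$\mathrm{Top}(\phi)=\{y\in \mathrm{Top}\mid a\,y=\phi(a)\,y\ \text{ for all } a\in N\}$$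 is nonzero. -/

import Mathlib

open scoped Polynomial

noncomputable section

namespace WeilUnitary

/-! ### The ring `A = R[X]/(X² - p, X^(2ℓ-1))` with its involution -/

section Ring

variable {R : Type*} [CommRing R]

/-- The ideal `(X² - p, X^(2ℓ-1))` of `R[X]`. -/
def extIdeal (p : R) (ℓ : ℕ) : Ideal R[X] :=
  Ideal.span {Polynomial.X ^ 2 - Polynomial.C p, Polynomial.X ^ (2 * ℓ - 1)}

/-- The ring `A = R[X]/(X² - p, X^(2ℓ-1))`. -/
abbrev RamExt (p : R) (ℓ : ℕ) : Type _ := R[X] ⧸ extIdeal p ℓ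

/-- The element `π` of `A`, the image of `X`. -/
def extPi (p : R) (ℓ : ℕ) : RamExt p ℓ := Ideal.Quotient.mk (extIdeal p ℓ) Polynomial.X

lemma extIdeal_le_comap (p : R) (ℓ : ℕ) :
    extIdeal p ℓ ≤ (extIdeal p ℓ).comap
      (Polynomial.aeval (-Polynomial.X : R[X])).toRingHom := by
  rw [extIdeal, Ideal.span_le]
  rintro x (rfl | rfl)
  · refine Ideal.subset_span (Or.inl ?_)
    simp [Polynomial.algebraMap_eq]
  · have h : (-Polynomial.X : R[X]) ^ (2 * ℓ - 1) =
        (-1) ^ (2 * ℓ - 1) * Polynomial.X ^ (2 * ℓ - 1) := neg_pow _ _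
    simp only [SetLike.mem_coe, Ideal.mem_comap, AlgHom.toRingHom_eq_coe, RingHom.coe_coe,
      map_pow, Polynomial.aeval_X]
    rw [h]
    exact Ideal.mul_mem_left _ _ (Ideal.subset_span (Or.inr rfl))

/-- The involution `*` of `A`, induced by the `R`-algebra endomorphism `X ↦ -X` of `R[X]`. -/
def invol (p : R) (ℓ : ℕ) : RamExt p ℓ →+* RamExt p ℓ :=
  Ideal.quotientMap (extIdeal p ℓ) (Polynomial.aeval (-Polynomial.X : R[X])).toRingHom
    (extIdeal_le_comap p ℓ)

lemma invol_mk (p : R) (ℓ : ℕ) (g : R[X]) :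
    invol p ℓ (Ideal.Quotient.mk (extIdeal p ℓ) g) =
      Ideal.Quotient.mk (extIdeal p ℓ) (Polynomial.aeval (-Polynomial.X : R[X]) g) := by
  simp [invol]

lemma invol_algebraMap (p : R) (ℓ : ℕ) (r : R) :
    invol p ℓ (algebraMap R (RamExt p ℓ) r) = algebraMap R (RamExt p ℓ) r := by
  have : algebraMap R (RamExt p ℓ) r = Ideal.Quotient.mk (extIdeal p ℓ) (Polynomial.C r) := rfl
  rw [this, invol_mk]
  simp [Polynomial.algebraMap_eq]

lemma invol_pi (p : R) (ℓ : ℕ) : invol p ℓ (extPi p ℓ) = -extPi p ℓ := by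
  rw [extPi, invol_mk]
  simp

lemma invol_invol (p : R) (ℓ : ℕ) (a : RamExt p ℓ) : invol p ℓ (invol p ℓ a) = a := by
  obtain ⟨g, rfl⟩ := Ideal.Quotient.mk_surjective a
  rw [invol_mk, invol_mk]
  congr 1
  have : (Polynomial.aeval (-Polynomial.X : R[X])).comp
      (Polynomial.aeval (-Polynomial.X : R[X])) = AlgHom.id R R[X] := by
    ext; simp
  exact DFunLike.congr_fun this g

/-- The `R`-linear map `R[X] → R` with `X^(2i) ↦ p^i` and `X^(2i+1) ↦ 0`. -/
def polyEvenPart (p : R) : R[X] →ₗ[R] R :=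
  Polynomial.lsum fun n => if Even n then p ^ (n / 2) • LinearMap.id else 0

lemma polyEvenPart_monomial (p : R) (n : ℕ) (r : R) :
    polyEvenPart p (Polynomial.monomial n r) = if Even n then p ^ (n / 2) * r else 0 := by
  rw [polyEvenPart, Polynomial.lsum_apply, Polynomial.sum_monomial_index]
  · split_ifs <;> simp
  · simp

lemma polyEvenPart_eq_zero {p : R} {ℓ : ℕ} (hp : p ^ ℓ = 0) {g : R[X]}
    (hg : g ∈ extIdeal p ℓ) : polyEvenPart p g = 0 := by
  obtain ⟨u, v, rfl⟩ := Ideal.mem_span_pair.1 hg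
  rw [map_add]
  have h1 : ∀ u : R[X], polyEvenPart p (u * (Polynomial.X ^ 2 - Polynomial.C p)) = 0 := by
    intro u
    induction u using Polynomial.induction_on' with
    | add a b ha hb => rw [add_mul, map_add, ha, hb, add_zero]
    | monomial n r =>
      rw [mul_sub, map_sub, Polynomial.X_pow_eq_monomial, Polynomial.monomial_mul_monomial,
        Polynomial.monomial_mul_C, polyEvenPart_monomial, polyEvenPart_monomial]
      have : Even (n + 2) ↔ Even n := by simp [Nat.even_add]
      simp only [this]
      split_ifs
      · rw [Nat.add_div_right _ two_pos, pow_succ]; ring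
      · simp
  have h2 : ∀ v : R[X], polyEvenPart p (v * Polynomial.X ^ (2 * ℓ - 1)) = 0 := by
    intro v
    induction v using Polynomial.induction_on' with
    | add a b ha hb => rw [add_mul, map_add, ha, hb, add_zero]
    | monomial n r =>
      rw [Polynomial.X_pow_eq_monomial, Polynomial.monomial_mul_monomial, polyEvenPart_monomial]
      split_ifs with h
      · have hle : ℓ ≤ (n + (2 * ℓ - 1)) / 2 := by
          obtain ⟨k, hk⟩ := h
          omega
        rw [pow_eq_zero_of_le hle hp, zero_mul]
      · rfl
  rw [h1, h2, add_zero]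

/-- The `R`-component of an element of `A = R ⊕ Rπ`: the `R`-linear map `A → R` which sends
`r + sπ` to `r`, for `r, s ∈ R`. It is well defined because `p ^ ℓ = 0`. -/
def evenPart {p : R} {ℓ : ℕ} (hp : p ^ ℓ = 0) : RamExt p ℓ →ₗ[R] R :=
  ((extIdeal p ℓ).restrictScalars R).liftQ (polyEvenPart p)
      (fun _ hg => polyEvenPart_eq_zero hp hg) ∘ₗ
    (Submodule.Quotient.restrictScalarsEquiv R (extIdeal p ℓ)).symm.toLinearMap

lemma evenPart_mk {p : R} {ℓ : ℕ} (hp : p ^ ℓ = 0) (g : R[X]) :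
    evenPart hp (Ideal.Quotient.mk (extIdeal p ℓ) g) = polyEvenPart p g := rfl

/-- `R` embeds into `A`, and `evenPart` restricts to the identity on `R`. -/
lemma evenPart_algebraMap {p : R} {ℓ : ℕ} (hp : p ^ ℓ = 0) (r : R) :
    evenPart hp (algebraMap R (RamExt p ℓ) r) = r := by
  have : algebraMap R (RamExt p ℓ) r =
      Ideal.Quotient.mk (extIdeal p ℓ) (Polynomial.monomial 0 r) := rfl
  rw [this, evenPart_mk, polyEvenPart_monomial]
  simp

/-- In `A` one has `evenPart a = (a + a*)/2`. -/
lemma two_mul_evenPart {p : R} {ℓ : ℕ} (hp : p ^ ℓ = 0) (a : RamExt p ℓ) :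
    2 * algebraMap R (RamExt p ℓ) (evenPart hp a) = a + invol p ℓ a := by
  obtain ⟨g, rfl⟩ := Ideal.Quotient.mk_surjective a
  rw [evenPart_mk, invol_mk]
  induction g using Polynomial.induction_on' with
  | add a b ha hb => simp only [map_add, mul_add, ha, hb]; ring
  | monomial n r =>
    have hpi : Ideal.Quotient.mk (extIdeal p ℓ) Polynomial.X ^ 2 =
        algebraMap R (RamExt p ℓ) p := by
      rw [← map_pow]
      exact Ideal.Quotient.eq.2 (Ideal.subset_span (Or.inl rfl))
    have hmon : Ideal.Quotient.mk (extIdeal p ℓ) (Polynomial.monomial n r) =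
        algebraMap R (RamExt p ℓ) r * Ideal.Quotient.mk (extIdeal p ℓ) Polynomial.X ^ n := by
      rw [← Polynomial.C_mul_X_pow_eq_monomial, map_mul, map_pow]
      rfl
    rw [polyEvenPart_monomial, Polynomial.aeval_monomial, map_mul, map_pow, map_neg, hmon]
    have hC : Ideal.Quotient.mk (extIdeal p ℓ) (algebraMap R R[X] r) =
        algebraMap R (RamExt p ℓ) r := rfl
    rw [hC]
    split_ifs with h
    · obtain ⟨k, rfl⟩ := h
      have key : ∀ y : RamExt p ℓ, (-y) ^ (k + k) = y ^ (k + k) := fun y => Even.neg_pow ⟨k, rfl⟩ y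
      rw [key]
      have : (k + k) / 2 = k := by omega
      rw [this, map_mul, map_pow, ← hpi]
      ring
    · have key : ∀ y : RamExt p ℓ, (-y) ^ n = -y ^ n := fun y =>
        Odd.neg_pow (Nat.not_even_iff_odd.1 h) y
      rw [key, map_zero]
      ring

/-- The kernel `N = {a ∈ Aˣ | a a* = 1}` of the norm map. -/
def normOne (p : R) (ℓ : ℕ) : Subgroup (RamExt p ℓ)ˣ where
  carrier := {a | (a : RamExt p ℓ) * invol p ℓ a = 1}
  one_mem' := by simp
  mul_mem' := by
    intro a b ha hb
    simp only [Set.mem_ofPred_eq] at ha hb ⊢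
    rw [Units.val_mul, map_mul, mul_mul_mul_comm, ha, hb, one_mul]
  inv_mem' := by
    intro a ha
    simp only [Set.mem_ofPred_eq] at ha ⊢
    have h1 : (a : RamExt p ℓ) * ((a⁻¹ : (RamExt p ℓ)ˣ) : RamExt p ℓ) = 1 := a.mul_inv
    have h2 := congrArg (invol p ℓ) h1
    rw [map_mul, map_one] at h2
    calc ((a⁻¹ : (RamExt p ℓ)ˣ) : RamExt p ℓ) * invol p ℓ ((a⁻¹ : (RamExt p ℓ)ˣ) : RamExt p ℓ)
        = ((a : RamExt p ℓ) * invol p ℓ a) * (((a⁻¹ : (RamExt p ℓ)ˣ) : RamExt p ℓ) *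
            invol p ℓ ((a⁻¹ : (RamExt p ℓ)ˣ) : RamExt p ℓ)) := by rw [ha, one_mul]
      _ = ((a : RamExt p ℓ) * ((a⁻¹ : (RamExt p ℓ)ˣ) : RamExt p ℓ)) *
            (invol p ℓ a * invol p ℓ ((a⁻¹ : (RamExt p ℓ)ˣ) : RamExt p ℓ)) := by ring
      _ = 1 := by rw [h1, h2, one_mul]

end Ring

/-! ### The Heisenberg group and its Schrödinger and Weil representations -/

section Heisenberg

variable {R V : Type*} [CommRing R] [AddCommGroup V] [Module R V]

/-- The symplectic group `Sp(V, f)` of all `R`-linear automorphisms of `V` preserving `f`. -/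
def symplecticGroup (f : V →ₗ[R] V →ₗ[R] R) : Subgroup (V ≃ₗ[R] V) where
  carrier := {g | ∀ u v, f (g u) (g v) = f u v}
  one_mem' := fun _ _ => rfl
  mul_mem' := by
    intro a b ha hb u v
    rw [LinearEquiv.mul_apply, LinearEquiv.mul_apply, ha, hb]
  inv_mem' := by
    intro a ha u v
    rw [← ha (a⁻¹ u) (a⁻¹ v), ← LinearEquiv.mul_apply, ← LinearEquiv.mul_apply, mul_inv_cancel]
    rfl

/-- A character of `R⁺` is primitive if and only if its kernel contains no nonzero ideal of `R`. -/
lemma isPrimitive_iff (lam : AddChar R ℂ) :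
    lam.IsPrimitive ↔ ∀ I : Ideal R, (∀ r ∈ I, lam r = 1) → I = ⊥ := by
  constructor
  · intro hl I hI
    rw [eq_bot_iff]
    intro a ha
    by_contra hne
    refine hl (a := a) (fun h0 => hne (by simp [h0])) ?_
    ext r
    rw [AddChar.mulShift_apply, hI _ (I.mul_mem_right r ha), AddChar.one_apply]
  · intro hl a ha h1
    refine ha (Ideal.span_singleton_eq_bot.1 (hl _ fun r hr => ?_))
    obtain ⟨c, rfl⟩ := Ideal.mem_span_singleton.1 hr
    rw [← AddChar.mulShift_apply, h1, AddChar.one_apply]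

/-- The set `R × V` underlying the Heisenberg group of `f`. -/
@[ext]
structure Heisenberg (f : V →ₗ[R] V →ₗ[R] R) where
  /-- the central component -/
  r : R
  /-- the vector component -/
  u : V

variable {f : V →ₗ[R] V →ₗ[R] R}

/-- The group law `(r, u)(s, v) = (r + s + f(u, v), u + v)`. -/
instance : Group (Heisenberg f) where
  mul k l := ⟨k.r + l.r + f k.u l.u, k.u + l.u⟩
  one := ⟨0, 0⟩
  inv k := ⟨-k.r + f k.u k.u, -k.u⟩
  mul_assoc := by
    rintro ⟨r, u⟩ ⟨s, v⟩ ⟨t, w⟩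
    change Heisenberg.mk (f := f) (r + s + f u v + t + f (u + v) w) (u + v + w) =
      ⟨r + (s + t + f v w) + f u (v + w), u + (v + w)⟩
    ext
    · simp only [map_add, LinearMap.add_apply]; ring
    · exact add_assoc _ _ _
  one_mul := by
    rintro ⟨r, u⟩
    change Heisenberg.mk (f := f) (0 + r + f 0 u) (0 + u) = ⟨r, u⟩
    simp
  mul_one := by
    rintro ⟨r, u⟩
    change Heisenberg.mk (f := f) (r + 0 + f u 0) (u + 0) = ⟨r, u⟩
    simp
  inv_mul_cancel := by
    rintro ⟨r, u⟩
    change Heisenberg.mk (f := f) (-r + f u u + r + f (-u) u) (-u + u) = ⟨0, 0⟩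
    simp

lemma Heisenberg.mul_def (k l : Heisenberg f) :
    k * l = ⟨k.r + l.r + f k.u l.u, k.u + l.u⟩ := rfl

/-- The action `g • (r, u) = (r, g u)` of `Sp(V, f)` on the Heisenberg group by automorphisms. -/
instance : MulDistribMulAction (symplecticGroup f) (Heisenberg f) where
  smul g k := ⟨k.r, (g : V ≃ₗ[R] V) k.u⟩
  one_smul _ := rfl
  mul_smul _ _ _ := rfl
  smul_mul g k l := by
    change Heisenberg.mk (f := f) (k.r + l.r + f k.u l.u) ((g : V ≃ₗ[R] V) (k.u + l.u)) =
      ⟨k.r + l.r + f ((g : V ≃ₗ[R] V) k.u) ((g : V ≃ₗ[R] V) l.u),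
        (g : V ≃ₗ[R] V) k.u + (g : V ≃ₗ[R] V) l.u⟩
    rw [g.2 k.u l.u, map_add]
  smul_one g := by
    change Heisenberg.mk (f := f) 0 ((g : V ≃ₗ[R] V) 0) = ⟨0, 0⟩
    rw [map_zero]

lemma smul_def (g : symplecticGroup f) (k : Heisenberg f) : g • k = ⟨k.r, (g : V ≃ₗ[R] V) k.u⟩ := rfl

variable {X : Type*} [AddCommGroup X] [Module ℂ X]

/-- `S` is a Schrödinger representation of type `lam`: it is irreducible, and the central
subgroup `(R, 0)` acts through the character `lam`. -/
structure IsSchrodinger (lam : AddChar R ℂ) (S : Representation ℂ (Heisenberg f) X) : Prop where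
  irreducible : S.IsIrreducible
  central : ∀ (r : R) (x : X), S ⟨r, 0⟩ x = lam r • x

/-- `W` is a Weil representation of the subgroup `G` of `Sp(V, f)`, relative to `S`:
`W(g) S(k) W(g)⁻¹ = S(g • k)` for all `g ∈ G` and all `k` in the Heisenberg group. -/
def IsWeil (S : Representation ℂ (Heisenberg f) X) {G : Subgroup (symplecticGroup f)}
    (W : Representation ℂ G X) : Prop :=
  ∀ (g : G) (k : Heisenberg f), W g * S k * W g⁻¹ = S ((g : symplecticGroup f) • k)

/-- `X(U)`: the vectors of `X` fixed by `S(0, u)` for all `u ∈ U`. -/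
def fixedBy (S : Representation ℂ (Heisenberg f) X) (U : Submodule R V) : Submodule ℂ X where
  carrier := {x | ∀ u ∈ U, S ⟨0, u⟩ x = x}
  zero_mem' := fun _ _ => map_zero _
  add_mem' := by
    intro x y hx hy u hu
    rw [map_add, hx u hu, hy u hu]
  smul_mem' := by
    intro c x hx u hu
    rw [map_smul, hx u hu]

/-- `Bot = X(𝔫V)`, where `𝔫 = R p^(ℓ-1)`. -/
def botLayer (p : R) (ℓ : ℕ) (S : Representation ℂ (Heisenberg f) X) : Submodule ℂ X :=
  fixedBy S (Ideal.span {p ^ (ℓ - 1)} • (⊤ : Submodule R V))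

lemma IsWeil.bot_le_comap {S : Representation ℂ (Heisenberg f) X} {G : Subgroup (symplecticGroup f)}
    {W : Representation ℂ G X} (hW : IsWeil S W) (p : R) (ℓ : ℕ) (g : G) :
    botLayer p ℓ S ≤ (botLayer p ℓ S).comap (W g) := by
  intro x hx u hu
  have hu' : ((g⁻¹ : G) : V ≃ₗ[R] V) u ∈
      (Ideal.span {p ^ (ℓ - 1)} • (⊤ : Submodule R V)) := by
    have := Submodule.mem_map_of_mem (f := (((g⁻¹ : G) : V ≃ₗ[R] V) : V →ₗ[R] V)) hu
    rw [Submodule.map_smul''] at this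
    exact Submodule.smul_mono le_rfl le_top this
  have hg : (g : symplecticGroup f) • (⟨0, ((g⁻¹ : G) : V ≃ₗ[R] V) u⟩ : Heisenberg f) = ⟨0, u⟩ := by
    change (g : symplecticGroup f) • (((g⁻¹ : G) : symplecticGroup f) • (⟨0, u⟩ : Heisenberg f)) = ⟨0, u⟩
    rw [Subgroup.coe_inv, smul_inv_smul]
  have hk := DFunLike.congr_fun (hW g ⟨0, ((g⁻¹ : G) : V ≃ₗ[R] V) u⟩) (W g x)
  rw [hg] at hk
  rw [← hk, Module.End.mul_apply, Module.End.mul_apply, ← Module.End.mul_apply (W g⁻¹),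
    ← map_mul, inv_mul_cancel, map_one, Module.End.one_apply, hx _ hu']

/-- The representation of `G` on `Top = X/Bot` afforded by a Weil representation of `G`. -/
def topRep {S : Representation ℂ (Heisenberg f) X} {G : Subgroup (symplecticGroup f)}
    {W : Representation ℂ G X} (hW : IsWeil S W) (p : R) (ℓ : ℕ) :
    Representation ℂ G (X ⧸ botLayer p ℓ S) :=
  W.quotient (botLayer p ℓ S) (hW.bot_le_comap p ℓ)

/-- The eigenspace `Y(φ) = {y ∈ Y | a y = φ(a) y for all a ∈ N}`. -/
def eigenspace {N Y : Type*} [Group N] [AddCommGroup Y] [Module ℂ Y]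
    (ρ : Representation ℂ N Y) (φ : N →* ℂˣ) : Submodule ℂ Y where
  carrier := {y | ∀ a, ρ a y = (φ a : ℂ) • y}
  zero_mem' := by simp
  add_mem' := by
    intro x y hx hy a
    rw [map_add, hx a, hy a, smul_add]
  smul_mem' := by
    intro c x hx a
    rw [map_smul, hx a, smul_comm]

end Heisenberg

/-! ### Skew hermitian forms, the unitary group and its embedding into the symplectic group -/

section Unitary

variable {R V : Type*} [CommRing R] {p : R} {ℓ : ℕ} [AddCommGroup V] [Module (RamExt p ℓ) V]

/-- `h`, which is `*`-linear in the first and linear in the second variable, is a nondegenerate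
skew hermitian form. -/
structure IsNondegSkewHermitian (h : V →ₛₗ[invol p ℓ] V →ₗ[RamExt p ℓ] RamExt p ℓ) : Prop where
  skew : ∀ u v, h v u = -invol p ℓ (h u v)
  nondeg : Function.Injective h

/-- The unitary group `U(V, h)` of all `A`-linear automorphisms of `V` preserving `h`. -/
def unitaryGroup (h : V →ₛₗ[invol p ℓ] V →ₗ[RamExt p ℓ] RamExt p ℓ) : Subgroup (V ≃ₗ[RamExt p ℓ] V) where
  carrier := {g | ∀ u v, h (g u) (g v) = h u v}
  one_mem' := fun _ _ => rfl
  mul_mem' := by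
    intro a b ha hb u v
    rw [LinearEquiv.mul_apply, LinearEquiv.mul_apply, ha, hb]
  inv_mem' := by
    intro a ha u v
    rw [← ha (a⁻¹ u) (a⁻¹ v), ← LinearEquiv.mul_apply, ← LinearEquiv.mul_apply, mul_inv_cancel]
    rfl

/-- The identification of `a ∈ N` with the element `a · 1_V` of `U(V, h)`. -/
def normToUnitary (h : V →ₛₗ[invol p ℓ] V →ₗ[RamExt p ℓ] RamExt p ℓ) : normOne p ℓ →* unitaryGroup h where
  toFun a := ⟨LinearEquiv.smulOfUnit (a : (RamExt p ℓ)ˣ), fun u v => by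
    have ha : ((a : (RamExt p ℓ)ˣ) : RamExt p ℓ) * invol p ℓ (a : (RamExt p ℓ)ˣ) = 1 := a.2
    change h (((a : (RamExt p ℓ)ˣ) : RamExt p ℓ) • u) (((a : (RamExt p ℓ)ˣ) : RamExt p ℓ) • v) = h u v
    rw [map_smul (h _), LinearMap.map_smulₛₗ h, LinearMap.smul_apply, smul_smul, ha, one_smul]⟩
  map_one' := by
    ext v
    exact one_smul _ v
  map_mul' a b := by
    ext v
    exact mul_smul ((a : (RamExt p ℓ)ˣ) : RamExt p ℓ) ((b : (RamExt p ℓ)ˣ) : RamExt p ℓ) v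

lemma normToUnitary_apply (h : V →ₛₗ[invol p ℓ] V →ₗ[RamExt p ℓ] RamExt p ℓ) (a : normOne p ℓ) (v : V) :
    (normToUnitary h a : V ≃ₗ[RamExt p ℓ] V) v = ((a : (RamExt p ℓ)ˣ) : RamExt p ℓ) • v := rfl

/-- `N` is central in `U(V, h)`. -/
lemma normToUnitary_mem_center (h : V →ₛₗ[invol p ℓ] V →ₗ[RamExt p ℓ] RamExt p ℓ) (a : normOne p ℓ) :
    normToUnitary h a ∈ Subgroup.center (unitaryGroup h) := by
  rw [Subgroup.mem_center_iff]
  intro g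
  ext v
  exact map_smul (g : V ≃ₗ[RamExt p ℓ] V) ((a : (RamExt p ℓ)ˣ) : RamExt p ℓ) v

/-! `V` is now viewed as an `R`-module as well. -/

variable [Module R V] [IsScalarTower R (RamExt p ℓ) V]

/-- The form `f : V × V → R` associated to `h`: `f(u, v)` is the `R`-component
`(h(u, v) + h(u, v)*)/2` of `h(u, v)`. -/
def altForm (hp : p ^ ℓ = 0) (h : V →ₛₗ[invol p ℓ] V →ₗ[RamExt p ℓ] RamExt p ℓ) :
    V →ₗ[R] V →ₗ[R] R :=
  LinearMap.mk₂ R (fun u v => evenPart hp (h u v))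
    (fun u u' v => by simp)
    (fun c u v => by
      rw [← algebraMap_smul (RamExt p ℓ) c u, LinearMap.map_smulₛₗ, invol_algebraMap,
        LinearMap.smul_apply, algebraMap_smul, map_smul])
    (fun u v v' => by simp)
    (fun c u v => by
      rw [← algebraMap_smul (RamExt p ℓ) c v, map_smul, algebraMap_smul, map_smul])

lemma altForm_apply (hp : p ^ ℓ = 0) (h : V →ₛₗ[invol p ℓ] V →ₗ[RamExt p ℓ] RamExt p ℓ) (u v : V) :
    altForm hp h u v = evenPart hp (h u v) := rfl

/-- The inclusion of `U(V, h)` into `Sp(V, f)`. -/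
def unitaryToSp (hp : p ^ ℓ = 0) (h : V →ₛₗ[invol p ℓ] V →ₗ[RamExt p ℓ] RamExt p ℓ) :
    unitaryGroup h →* symplecticGroup (altForm hp h) where
  toFun g := ⟨(g : V ≃ₗ[RamExt p ℓ] V).restrictScalars R, fun u v => by
    rw [altForm_apply, altForm_apply]
    exact congrArg _ (g.2 u v)⟩
  map_one' := rfl
  map_mul' _ _ := rfl

/-- `N` as a group of elements of `Sp(V, f)`, acting on `V` by scalar multiplication. -/
def normToSp (hp : p ^ ℓ = 0) (h : V →ₛₗ[invol p ℓ] V →ₗ[RamExt p ℓ] RamExt p ℓ) :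
    normOne p ℓ →* symplecticGroup (altForm hp h) :=
  (unitaryToSp hp h).comp (normToUnitary h)

/-- `N` as a group of elements of a subgroup `G` of `Sp(V, f)` which contains `N`. -/
def normToSubgroup (hp : p ^ ℓ = 0) (h : V →ₛₗ[invol p ℓ] V →ₗ[RamExt p ℓ] RamExt p ℓ)
    {G : Subgroup (symplecticGroup (altForm hp h))} (hG : (normToSp hp h).range ≤ G) : normOne p ℓ →* G :=
  (normToSp hp h).codRestrict G fun a => hG ⟨a, rfl⟩

end Unitary

end WeilUnitary

end

open WeilUnitary

open WeilUnitary

namespace WeilUnitary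

open Polynomial

/-! ### Arithmetic of the chain ring `A` -/

section RingFacts

variable {R : Type*} [CommRing R] {p : R} {ℓ : ℕ}

/-! The group `N` acts on `V` by scalars, so it preserves every cyclic submodule `Au`. If `h u u =
0`, then `f` vanishes on `Au`, and `a ↦ S(0, au)` is a representation of the finite additive group
of `A`. Let `x` be an eigenvector with character `μ`. Then `b ∈ N` carries `x` to an eigenvector
with character `a ↦ μ(b⁻¹a)`. If `μ` is primitive, these characters are distinct for distinct `b`,
so the orbit of `x` spans a copy of the regular representation of `N`, and `y = ∑ φ(b)⁻¹ b x` is a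
nonzero `φ`-eigenvector.

This `y` is not in Bot. Primitivity gives `n` in the minimal ideal of `A` with `μ(n) ≠ 1`, while a
vector of Bot is fixed by `S(0, nu)` and so has zero component in the `μ`-eigenspace. The component
of `y` there is `x` (`sum_smul_apply_sum_eq_card_smul`).

Two existence results remain. A hyperbolic vector `u` comes from solving a quadratic equation over
`R` (`IsNondegSkewHermitian.exists_isotropic`). A primitive `μ` occurs because `S(0, w)`, with `h u
w = 1`, twists the available characters by a character nontrivial at `n`; nontriviality there
suffices, since the ideals of `A` have a common minimal one (`dvd_algebraMap_pow`). -/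

lemma extPi_sq (p : R) (ℓ : ℕ) : extPi p ℓ ^ 2 = algebraMap R (RamExt p ℓ) p := by
  rw [extPi, ← map_pow]
  exact Ideal.Quotient.eq.2 (Ideal.subset_span (Or.inl rfl))

lemma extPi_pow_eq_zero (p : R) (ℓ : ℕ) : extPi p ℓ ^ (2 * ℓ - 1) = 0 := by
  rw [extPi, ← map_pow]
  exact Ideal.Quotient.eq_zero_iff_mem.2 (Ideal.subset_span (Or.inr rfl))

lemma extPi_pow_two_mul (p : R) (ℓ n : ℕ) :
    extPi p ℓ ^ (2 * n) = algebraMap R (RamExt p ℓ) (p ^ n) := by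
  rw [pow_mul, extPi_sq, map_pow]

/-- Every element of `A` has the form `r + sπ`. -/
lemma exists_eq_add_mul_extPi (a : RamExt p ℓ) :
    ∃ r s : R, a = algebraMap R _ r + algebraMap R _ s * extPi p ℓ := by
  obtain ⟨g, rfl⟩ := Ideal.Quotient.mk_surjective a
  induction g using Polynomial.induction_on' with
  | add a b ha hb =>
    obtain ⟨r, s, h1⟩ := ha
    obtain ⟨r', s', h2⟩ := hb
    refine ⟨r + r', s + s', ?_⟩
    rw [map_add, h1, h2, map_add, map_add]
    ring
  | monomial n r =>
    have hmon : Ideal.Quotient.mk (extIdeal p ℓ) (Polynomial.monomial n r) =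
        algebraMap R (RamExt p ℓ) r * extPi p ℓ ^ n := by
      rw [← Polynomial.C_mul_X_pow_eq_monomial, map_mul, map_pow]
      rfl
    rw [hmon]
    obtain ⟨k, rfl | rfl⟩ := Nat.even_or_odd' n
    · exact ⟨r * p ^ k, 0, by rw [extPi_pow_two_mul]; simp⟩
    · exact ⟨0, r * p ^ k, by rw [pow_succ, extPi_pow_two_mul, map_mul, map_zero]; ring⟩

instance [Finite R] : Finite (RamExt p ℓ) :=
  Finite.of_surjective
    (fun x : R × R => algebraMap R (RamExt p ℓ) x.1 + algebraMap R _ x.2 * extPi p ℓ)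
    fun a => by
      obtain ⟨r, s, h⟩ := exists_eq_add_mul_extPi a
      exact ⟨(r, s), h.symm⟩

lemma evenPart_add_mul_extPi (hp : p ^ ℓ = 0) (r s : R) :
    evenPart hp (algebraMap R _ r + algebraMap R _ s * extPi p ℓ) = r := by
  have h1 : evenPart hp (extPi p ℓ) = 0 := by
    rw [extPi, evenPart_mk, ← Polynomial.monomial_one_one_eq_X, polyEvenPart_monomial]
    simp
  rw [map_add, evenPart_algebraMap, ← Algebra.smul_def, map_smul, h1, smul_zero, add_zero]

lemma invol_add_mul_extPi (r s : R) :
    invol p ℓ (algebraMap R _ r + algebraMap R _ s * extPi p ℓ) =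
      algebraMap R _ r + algebraMap R _ (-s) * extPi p ℓ := by
  rw [map_add, map_mul, invol_algebraMap, invol_algebraMap, invol_pi, map_neg]
  ring

lemma evenPart_invol (hp : p ^ ℓ = 0) (a : RamExt p ℓ) :
    evenPart hp (invol p ℓ a) = evenPart hp a := by
  obtain ⟨r, s, rfl⟩ := exists_eq_add_mul_extPi a
  rw [invol_add_mul_extPi, evenPart_add_mul_extPi, evenPart_add_mul_extPi]

lemma algebraMap_ramExt_injective (hp : p ^ ℓ = 0) :
    Function.Injective (algebraMap R (RamExt p ℓ)) :=
  Function.LeftInverse.injective (evenPart_algebraMap hp)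

variable [IsLocalRing R]

/-- An element of `A` is a unit or a multiple of `π`. -/
lemma isUnit_or_extPi_dvd (hmax : IsLocalRing.maximalIdeal R = Ideal.span {p})
    (a : RamExt p ℓ) : IsUnit a ∨ extPi p ℓ ∣ a := by
  obtain ⟨r, s, rfl⟩ := exists_eq_add_mul_extPi a
  by_cases hr : IsUnit r
  · left
    -- A unit plus a multiple of the nilpotent `π` is a unit.
    refine IsNilpotent.isUnit_add_left_of_commute ?_ (hr.map _) (Commute.all _ _)
    exact (Commute.all _ _).isNilpotent_mul_left ⟨_, extPi_pow_eq_zero p ℓ⟩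
  · right
    rw [← mem_nonunits_iff, ← IsLocalRing.mem_maximalIdeal, hmax,
      Ideal.mem_span_singleton] at hr
    obtain ⟨c, rfl⟩ := hr
    refine dvd_add ?_ (dvd_mul_left _ _)
    rw [map_mul, ← extPi_sq, pow_two, mul_assoc]
    exact dvd_mul_right _ _

/-- `p^(ℓ-1)` lies in every nonzero ideal of `A`. -/
lemma dvd_algebraMap_pow (hmax : IsLocalRing.maximalIdeal R = Ideal.span {p})
    {b : RamExt p ℓ} (hb : b ≠ 0) : b ∣ algebraMap R _ (p ^ (ℓ - 1)) := by
  -- `i` is the `π`-adic valuation of `b`, which exists because `π` is nilpotent and `b ≠ 0`.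
  obtain ⟨i, hi, hi'⟩ : ∃ i, extPi p ℓ ^ i ∣ b ∧ ¬ extPi p ℓ ^ (i + 1) ∣ b := by
    by_contra! hcon
    have : ∀ i, extPi p ℓ ^ i ∣ b := fun i => by
      induction i with
      | zero => simp
      | succ i ih => exact hcon i ih
    have h0 := this (2 * ℓ - 1)
    rw [extPi_pow_eq_zero, zero_dvd_iff] at h0
    exact hb h0
  obtain ⟨c, rfl⟩ := hi
  rcases isUnit_or_extPi_dvd hmax c with hc | ⟨d, rfl⟩
  · rw [← extPi_pow_two_mul]
    have hlt : i < 2 * ℓ - 1 := by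
      by_contra! hle
      rw [pow_eq_zero_of_le hle (extPi_pow_eq_zero p ℓ), zero_mul] at hb
      exact hb rfl
    exact hc.mul_right_dvd.2 (pow_dvd_pow _ (by omega))
  · exact absurd ⟨d, by ring⟩ hi'

/-- The element `p^(ℓ-1) = π^(2ℓ-2)` is killed by `π`, hence by every non-unit. This turns
nondegeneracy of `h` into the existence of unit values. -/
lemma isUnit_of_pow_mul_ne_zero (hmax : IsLocalRing.maximalIdeal R = Ideal.span {p})
    (hℓ : 0 < ℓ) {a : RamExt p ℓ} (ha : algebraMap R _ (p ^ (ℓ - 1)) * a ≠ 0) : IsUnit a := by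
  rcases isUnit_or_extPi_dvd hmax a with h | ⟨d, rfl⟩
  · exact h
  · refine absurd ?_ ha
    rw [← extPi_pow_two_mul, ← mul_assoc, ← pow_succ,
      show 2 * (ℓ - 1) + 1 = 2 * ℓ - 1 by omega, extPi_pow_eq_zero, zero_mul]

lemma isUnit_two_of_odd_ringChar (hodd : Odd (ringChar (IsLocalRing.ResidueField R))) :
    IsUnit (2 : R) := by
  by_contra h2
  rw [← mem_nonunits_iff, ← IsLocalRing.mem_maximalIdeal, ← IsLocalRing.residue_eq_zero_iff,
    map_ofNat] at h2
  have h3 : ringChar (IsLocalRing.ResidueField R) ∣ 2 :=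
    ringChar.dvd (by exact_mod_cast h2)
  rcases (Nat.dvd_prime Nat.prime_two).1 h3 with h | h
  · exact CharP.ringChar_ne_one h
  · rw [h] at hodd
    exact absurd hodd (by decide)

/-- A quadratic polynomial whose leading coefficient is a non-unit and whose linear coefficient
is a unit takes every value on a finite local ring. -/
lemma exists_quadratic_eq_zero [Finite R] (h2 : IsUnit (2 : R))
    (hp : p ∈ IsLocalRing.maximalIdeal R) (α β : R) :
    ∃ s : R, α + 2 * s - p * β * s ^ 2 = 0 := by
  -- Values at `s` and `t` differ by `(s - t)(2 - pβ(s + t))`, whose second factor is a unit;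
  -- injectivity then gives surjectivity by finiteness.
  have hinj : Function.Injective fun s : R => 2 * s - p * β * s ^ 2 := by
    intro s t hst
    have hu : IsUnit (2 - p * β * (s + t)) := by
      by_contra hn
      rw [← mem_nonunits_iff, ← IsLocalRing.mem_maximalIdeal] at hn
      have h := (IsLocalRing.maximalIdeal R).add_mem hn
        (Ideal.mul_mem_right (s + t) _ (Ideal.mul_mem_right β _ hp))
      rw [sub_add_cancel, IsLocalRing.mem_maximalIdeal, mem_nonunits_iff] at h
      exact h h2
    have h0 : (2 - p * β * (s + t)) * (s - t) = 0 := by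
      simp only at hst
      linear_combination hst
    exact sub_eq_zero.1 ((hu.mul_right_eq_zero).1 h0)
  obtain ⟨s, hs⟩ := (Finite.injective_iff_surjective.1 hinj) (-α)
  exact ⟨s, by simp only at hs; linear_combination hs⟩

end RingFacts

/-! ### Hyperbolic vectors -/

section Isotropic

variable {R : Type*} [CommRing R] [Finite R] [IsLocalRing R] {p : R} {ℓ : ℕ}
  {V : Type*} [AddCommGroup V] [Module (RamExt p ℓ) V]

/-- A nondegenerate skew hermitian form on a nonzero free module has a hyperbolic vector. -/
lemma IsNondegSkewHermitian.exists_isotropic [Module.Free (RamExt p ℓ) V] [Nontrivial V]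
    (hℓ : 1 < ℓ) (hmax : IsLocalRing.maximalIdeal R = Ideal.span {p})
    (hp : p ^ ℓ = 0) (hp' : p ^ (ℓ - 1) ≠ 0) (h2 : IsUnit (2 : R))
    {h : V →ₛₗ[invol p ℓ] V →ₗ[RamExt p ℓ] RamExt p ℓ} (hh : IsNondegSkewHermitian h) :
    ∃ u w : V, h u u = 0 ∧ h u w = 1 := by
  have hpm : p ∈ IsLocalRing.maximalIdeal R := by
    rw [hmax]
    exact Ideal.mem_span_singleton_self p
  -- Skewness makes the `R`-component of `h u u` equal to its own negative, and `2` is a unit.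
  have hodd : ∀ u : V, ∃ α : R, h u u = algebraMap R _ α * extPi p ℓ := fun u => by
    obtain ⟨r, s, hrs⟩ := exists_eq_add_mul_extPi (h u u)
    have h1 := congrArg (evenPart hp) (hh.skew u u)
    rw [map_neg, evenPart_invol, hrs, evenPart_add_mul_extPi] at h1
    have h0 : r = 0 := h2.mul_right_eq_zero.1 (by linear_combination h1)
    exact ⟨s, by rw [hrs, h0, map_zero, zero_add]⟩
  let b := Module.Free.chooseBasis (RamExt p ℓ) V
  obtain ⟨i⟩ := b.index_nonempty
  have hu : algebraMap R (RamExt p ℓ) (p ^ (ℓ - 1)) • b i ≠ 0 := by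
    intro h0
    have h1 := congrArg (fun v => b.repr v i) h0
    simp only [map_smul, Module.Basis.repr_self, Finsupp.smul_apply, Finsupp.single_eq_same,
      map_zero, Finsupp.zero_apply, smul_eq_mul, mul_one] at h1
    exact hp' (algebraMap_ramExt_injective hp (h1.trans (map_zero _).symm))
  -- Otherwise `h (b i)` takes only non-unit values, and `p^(ℓ-1) b i ≠ 0` would lie in the radical.
  obtain ⟨v, hv⟩ : ∃ v, h (b i) v = 1 := by
    by_contra! hcon
    refine hu (hh.nondeg ?_)
    rw [map_zero]
    ext v
    rw [LinearMap.map_smulₛₗ, invol_algebraMap, LinearMap.smul_apply, LinearMap.zero_apply,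
      smul_eq_mul]
    by_contra hne
    obtain ⟨c, hc⟩ := (isUnit_of_pow_mul_ne_zero hmax (by omega) hne).exists_right_inv
    exact hcon (c • v) (by rw [map_smul, smul_eq_mul, mul_comm, hc])
  have hv' : h v (b i) = -1 := by rw [hh.skew (b i) v, hv, map_one]
  obtain ⟨α, hα⟩ := hodd (b i)
  obtain ⟨β, hβ⟩ := hodd v
  obtain ⟨s, hs⟩ := exists_quadratic_eq_zero h2 hpm α β
  have hs' := congrArg (algebraMap R (RamExt p ℓ)) hs
  simp only [map_sub, map_add, map_mul, map_pow, map_zero, map_ofNat] at hs'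
  have hsq := extPi_sq p ℓ
  -- With this choice `h u u = (α + 2s - pβs²)π`, which vanishes by the choice of `s`.
  set u : V := b i + (algebraMap R (RamExt p ℓ) s * extPi p ℓ) • v with hudef
  have huv : h u v = algebraMap R _ (1 - s * β * p) := by
    rw [hudef, LinearMap.map_add₂, LinearMap.map_smulₛₗ₂, hv, hβ,
      map_mul, invol_algebraMap, invol_pi, smul_eq_mul, map_sub, map_mul, map_mul, map_one]
    linear_combination (-algebraMap R (RamExt p ℓ) s * algebraMap R (RamExt p ℓ) β) * hsq
  have hunit : IsUnit (h u v) := by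
    rw [huv]
    refine IsUnit.map _ (IsNilpotent.isUnit_one_sub ?_)
    exact (Commute.all _ _).isNilpotent_mul_left ⟨ℓ, hp⟩
  obtain ⟨c, hc⟩ := hunit.exists_right_inv
  refine ⟨u, c • v, ?_, by rw [map_smul, smul_eq_mul, mul_comm, hc]⟩
  have hvu : h v u = -1 + algebraMap R _ s * extPi p ℓ * (algebraMap R _ β * extPi p ℓ) := by
    rw [hudef, map_add, map_smul, hv', hβ, smul_eq_mul]
  have hbu : h (b i) u = algebraMap R _ α * extPi p ℓ + algebraMap R _ s * extPi p ℓ := by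
    rw [hudef, map_add, map_smul, hα, hv, smul_eq_mul, mul_one]
  have : ∀ y, h u y = h (b i) y + invol p ℓ (algebraMap R _ s * extPi p ℓ) * h v y :=
    fun y => by rw [hudef, LinearMap.map_add₂, LinearMap.map_smulₛₗ₂, smul_eq_mul]
  rw [this, hbu, hvu, map_mul, invol_algebraMap, invol_pi]
  linear_combination extPi p ℓ * hs' - algebraMap R (RamExt p ℓ) s ^ 2 *
    algebraMap R (RamExt p ℓ) β * extPi p ℓ * hsq

end Isotropic

/-! ### Eigenvectors of finite abelian groups and averaging over `N` -/

section Eigenvectors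

variable {A X : Type*} [AddCommGroup X] [Module ℂ X]

/-- A representation of a finite abelian group on a nonzero complex vector space has a common
eigenvector. -/
lemma exists_common_eigenvector [AddCommGroup A] [Finite A] [Nontrivial X]
    (T : Multiplicative A →* Module.End ℂ X) :
    ∃ (μ : AddChar A ℂ) (x : X), x ≠ 0 ∧ ∀ a, T (.ofAdd a) x = μ a • x := by
  classical
  have := Fintype.ofFinite A
  obtain ⟨x, hx⟩ := exists_ne (0 : X)
  -- Fourier inversion: the unnormalised projections of `x` to all the eigenspaces add up to `|A|
  -- x`, so one of them is nonzero.
  have hsum : ∑ μ : AddChar A ℂ, ∑ a, μ (-a) • T (.ofAdd a) x = (Fintype.card A : ℂ) • x := by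
    rw [Finset.sum_comm]
    simp only [← Finset.sum_smul, AddChar.sum_apply_eq_ite, neg_eq_zero]
    rw [Finset.sum_eq_single 0]
    · simp
    · intro a _ ha
      simp [ha]
    · simp
  obtain ⟨μ, hμ⟩ : ∃ μ : AddChar A ℂ, ∑ a, μ (-a) • T (.ofAdd a) x ≠ 0 := by
    by_contra! hcon
    rw [Finset.sum_eq_zero fun μ _ => hcon μ] at hsum
    exact smul_ne_zero (Nat.cast_ne_zero.2 Fintype.card_ne_zero) hx hsum.symm
  refine ⟨μ, _, hμ, fun c => ?_⟩
  rw [map_sum, Finset.smul_sum]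
  refine Fintype.sum_equiv (Equiv.addLeft c) _ _ fun a => ?_
  rw [map_smul, ← Module.End.mul_apply, ← map_mul, ← ofAdd_add, smul_smul, Equiv.coe_addLeft,
    ← AddChar.map_add_eq_mul, neg_add, add_neg_cancel_left]

variable [CommRing A] [Fintype A] {N : Subgroup Aˣ} [Fintype N]

/-- If `x` is an eigenvector of `A⁺` with primitive character `μ`, and `N` permutes the
eigenspaces through multiplication, then projecting `∑ φ(b)⁻¹ b x` to the `μ`-eigenspace
gives a nonzero multiple of `x`. -/
lemma sum_smul_apply_sum_eq_card_smul (T : Multiplicative A →* Module.End ℂ X)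
    (ρ : Representation ℂ N X)
    (hρ : ∀ (b : N) (a : A) (x : X), T (.ofAdd (((b : Aˣ) : A) * a)) (ρ b x) = ρ b (T (.ofAdd a) x))
    {μ : AddChar A ℂ} (hμ : μ.IsPrimitive) {x : X} (hx : ∀ a, T (.ofAdd a) x = μ a • x)
    (φ : N →* ℂˣ) :
    ∑ a, μ (-a) • T (.ofAdd a) (∑ b, ((φ b)⁻¹ : ℂˣ).val • ρ b x) =
      (Fintype.card A : ℂ) • x := by
  classical
  have hTρ : ∀ (b : N) (a : A),
      T (.ofAdd a) (ρ b x) = μ (((b⁻¹ : N) : Aˣ) * a) • ρ b x := fun b a => by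
    have h1 := hρ b (((b⁻¹ : N) : Aˣ) * a) x
    rwa [← mul_assoc, ← Units.val_mul, ← Subgroup.coe_mul, mul_inv_cancel, Subgroup.coe_one,
      Units.val_one, one_mul, hx, map_smul] at h1
  simp only [map_sum, map_smul, Finset.smul_sum]
  rw [Finset.sum_comm, Finset.sum_eq_single 1]
  -- Only `b = 1` contributes: for `b ≠ 1` the sum over `a` is a complete sum of the nontrivial
  -- character `a ↦ μ(a(b⁻¹ - 1))`.
  · simp [hx, smul_smul, ← AddChar.map_add_eq_mul, Nat.cast_smul_eq_nsmul]
  · intro b _ hb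
    have hb' : (((b⁻¹ : N) : Aˣ) : A) - 1 ≠ 0 := fun h0 =>
      hb (inv_eq_one.1 (Subtype.ext (Units.ext (sub_eq_zero.1 h0))))
    have h1 := AddChar.sum_mulShift ((((b⁻¹ : N) : Aˣ) : A) - 1) hμ
    rw [if_neg hb'] at h1
    calc _ = (∑ a, μ (a * ((((b⁻¹ : N) : Aˣ) : A) - 1))) •
          (((φ b)⁻¹ : ℂˣ).val • ρ b x) := by
          rw [Finset.sum_smul]
          refine Finset.sum_congr rfl fun a _ => ?_
          rw [hTρ, smul_comm _ (μ _) (ρ b x), smul_smul, ← AddChar.map_add_eq_mul]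
          congr 2
          ring
      _ = 0 := by rw [h1, Nat.cast_zero, zero_smul]
  · simp

lemma apply_sum_smul_eq_smul {N : Type*} [Group N] [Fintype N] (ρ : Representation ℂ N X)
    (φ : N →* ℂˣ) (x : X) (c : N) :
    ρ c (∑ b, ((φ b)⁻¹ : ℂˣ).val • ρ b x) =
      (φ c : ℂ) • ∑ b, ((φ b)⁻¹ : ℂˣ).val • ρ b x := by
  rw [map_sum, Finset.smul_sum]
  refine Fintype.sum_equiv (Equiv.mulLeft c) _ _ fun b => ?_
  rw [map_smul, ← Module.End.mul_apply, ← map_mul, smul_smul, Equiv.coe_mulLeft, map_mul φ,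
    mul_inv, Units.val_mul, Units.mul_inv_cancel_left]

end Eigenvectors

/-! ### Heisenberg commutation and Weil equivariance -/

section Schrodinger

variable {R V X : Type*} [CommRing R] [AddCommGroup V] [Module R V]
  [AddCommGroup X] [Module ℂ X] {f : V →ₗ[R] V →ₗ[R] R}

lemma IsSchrodinger.apply_apply {lam : AddChar R ℂ} {S : Representation ℂ (Heisenberg f) X}
    (hS : IsSchrodinger lam S) (u v : V) (x : X) :
    S ⟨0, u⟩ (S ⟨0, v⟩ x) = lam (f u v) • S ⟨0, u + v⟩ x := by
  rw [← hS.central, ← Module.End.mul_apply, ← map_mul, ← Module.End.mul_apply, ← map_mul]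
  congr 2
  simp [Heisenberg.mul_def]

lemma IsSchrodinger.apply_apply_comm {lam : AddChar R ℂ}
    {S : Representation ℂ (Heisenberg f) X} (hS : IsSchrodinger lam S) (u v : V) (x : X) :
    S ⟨0, u⟩ (S ⟨0, v⟩ x) = lam (f u v - f v u) • S ⟨0, v⟩ (S ⟨0, u⟩ x) := by
  rw [hS.apply_apply, hS.apply_apply, smul_smul, ← AddChar.map_add_eq_mul, sub_add_cancel,
    add_comm]

lemma IsWeil.apply_apply {S : Representation ℂ (Heisenberg f) X}
    {G : Subgroup (symplecticGroup f)} {W : Representation ℂ G X} (hW : IsWeil S W) (g : G)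
    (v : V) (x : X) :
    S ⟨0, (g : V ≃ₗ[R] V) v⟩ (W g x) = W g (S ⟨0, v⟩ x) := by
  have h := DFunLike.congr_fun (hW g ⟨0, v⟩) (W g x)
  rw [smul_def] at h
  rw [← h, Module.End.mul_apply, Module.End.mul_apply, ← Module.End.mul_apply (W g⁻¹),
    ← map_mul, inv_mul_cancel, map_one, Module.End.one_apply]

/-- The restriction of a Schrödinger representation to an isotropic cyclic `A`-submodule. -/
def IsSchrodinger.cyclicRep {A : Type*} [Ring A] [Module A V] {lam : AddChar R ℂ}
    {S : Representation ℂ (Heisenberg f) X} (hS : IsSchrodinger lam S) {u : V}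
    (hu : ∀ a b : A, f (a • u) (b • u) = 0) : Multiplicative A →* Module.End ℂ X where
  toFun a := S ⟨0, a.toAdd • u⟩
  map_one' := by
    rw [toAdd_one, zero_smul]
    exact map_one S
  map_mul' a b := by
    ext x
    rw [Module.End.mul_apply, hS.apply_apply, hu, AddChar.map_zero_eq_one, one_smul, toAdd_mul,
      add_smul]

end Schrodinger

end WeilUnitary

/-! ### The eigenvector outside Bot -/

theorem mainTheorem7
    {R : Type*} [CommRing R] [Finite R] [IsLocalRing R]
    (p : R) (ℓ : ℕ) (hℓ : 1 < ℓ)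
    (hmax : IsLocalRing.maximalIdeal R = Ideal.span {p})
    (hp : p ^ ℓ = 0) (hp' : p ^ (ℓ - 1) ≠ 0)
    (hodd : Odd (ringChar (IsLocalRing.ResidueField R)))
    {V : Type*} [AddCommGroup V] [Module R V] [Module (RamExt p ℓ) V] [IsScalarTower R (RamExt p ℓ) V]
    [Module.Free (RamExt p ℓ) V] [Module.Finite (RamExt p ℓ) V] [Nontrivial V]
    (h : V →ₛₗ[invol p ℓ] V →ₗ[RamExt p ℓ] RamExt p ℓ) (hh : IsNondegSkewHermitian h)
    (lam : AddChar R ℂ) (hlam : lam.IsPrimitive)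
    {X : Type*} [AddCommGroup X] [Module ℂ X] [FiniteDimensional ℂ X]
    (S : Representation ℂ (Heisenberg (altForm hp h)) X) (hS : IsSchrodinger lam S)
    (G : Subgroup (symplecticGroup (altForm hp h))) (hG : (normToSp hp h).range ≤ G)
    (W : Representation ℂ G X) (hW : IsWeil S W)
    (φ : normOne p ℓ →* ℂˣ) :
    eigenspace ((topRep hW p ℓ).comp (normToSubgroup hp h hG)) φ ≠ ⊥ := by
  have := Fintype.ofFinite (RamExt p ℓ)
  have := Fintype.ofFinite (normOne p ℓ)
  have h2 := isUnit_two_of_odd_ringChar hodd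
  obtain ⟨u, w, huu, huw⟩ := hh.exists_isotropic hℓ hmax hp hp' h2
  have hiso : ∀ a b : RamExt p ℓ, altForm hp h (a • u) (b • u) = 0 := fun a b => by
    rw [altForm_apply, LinearMap.map_smulₛₗ₂, map_smul (h u), huu, smul_zero,
      smul_zero, map_zero]
  let T := hS.cyclicRep hiso
  have hT : ∀ a x, T (.ofAdd a) x = S ⟨0, a • u⟩ x := fun _ _ => rfl
  have hwu : h w u = -1 := by rw [hh.skew u w, huw, map_one]
  -- Since `h (au) w = a*` and `h w (au) = -a`, the commutator `f(au, w) - f(w, au)` is twice the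
  -- `R`-component of `a`.
  have hcomm : ∀ (a : RamExt p ℓ) (x : X),
      T (.ofAdd a) (S ⟨0, w⟩ x) = lam (2 * evenPart hp a) • S ⟨0, w⟩ (T (.ofAdd a) x) :=
    fun a x => by
      rw [hT, hT, hS.apply_apply_comm, altForm_apply, altForm_apply, LinearMap.map_smulₛₗ₂,
        map_smul (h w), huw, hwu, smul_eq_mul, smul_eq_mul, mul_one, show a * -1 = -a by ring, map_neg,
        evenPart_invol, sub_neg_eq_add, two_mul]
  have : Nontrivial X := by
    by_contra hX
    rw [not_nontrivial_iff_subsingleton] at hX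
    have := hS.irreducible
    exact bot_ne_top (α := Subrepresentation S) (SetLike.ext fun x => by
      rw [Subsingleton.elim x 0]
      exact iff_of_true (zero_mem (⊥ : Submodule ℂ X)) trivial)
  -- Primitivity of `lam` applied to `2p^(ℓ-1)`, nonzero because `2` is a unit.
  obtain ⟨r, hr⟩ : ∃ r : R, lam (2 * (p ^ (ℓ - 1) * r)) ≠ 1 := by
    by_contra! hcon
    refine hlam (a := 2 * p ^ (ℓ - 1)) (fun h0 => hp' (h2.mul_right_eq_zero.1 h0)) ?_
    ext r
    rw [AddChar.mulShift_apply, mul_assoc, hcon, AddChar.one_apply]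
  set n : RamExt p ℓ := algebraMap R _ (p ^ (ℓ - 1) * r) with hn
  obtain ⟨μ, x, hx0, hx, hμn⟩ : ∃ (μ : AddChar (RamExt p ℓ) ℂ) (x : X), x ≠ 0 ∧
      (∀ a, T (.ofAdd a) x = μ a • x) ∧ μ n ≠ 1 := by
    obtain ⟨μ, x, hx0, hx⟩ := exists_common_eigenvector T
    by_cases hμ : μ n = 1
    -- If `μ` is trivial at `n`, replace `x` by `S(0, w) x`: by `hcomm` its character is `μ` times
    -- `a ↦ lam(2 · evenPart a)`, which is nontrivial at `n`.
    · refine ⟨μ * lam.compAddMonoidHom (AddMonoidHom.mulLeft 2 |>.comp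
        (evenPart hp : RamExt p ℓ →+ R)), S ⟨0, w⟩ x, fun h0 => hx0 ?_, fun a => ?_, ?_⟩
      -- `S(0, -w)` inverts `S(0, w)` up to a nonzero scalar, so the new vector is nonzero.
      · have h1 := hS.apply_apply (-w) w x
        rw [h0, map_zero, neg_add_cancel] at h1
        have h3 : S ⟨0, 0⟩ x = x := congrArg (· x) (map_one S)
        rw [h3] at h1
        exact (smul_eq_zero.1 h1.symm).resolve_left (lam.val_isUnit _).ne_zero
      · rw [hcomm, hx, map_smul, smul_smul, mul_comm]
        rfl
      · rw [AddChar.mul_apply, hμ, one_mul]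
        change lam (2 * evenPart hp n) ≠ 1
        rwa [hn, evenPart_algebraMap]
    · exact ⟨μ, x, hx0, hx, hμ⟩
  have hμ : μ.IsPrimitive := by
    intro b hb h1
    -- Every nonzero `b` divides `p^(ℓ-1)`, hence `n`, so a `μ` trivial on `bA` would be trivial at
    -- `n`.
    obtain ⟨c, hc⟩ := dvd_algebraMap_pow hmax hb
    apply hμn
    rw [hn, map_mul, hc, mul_assoc, ← AddChar.mulShift_apply, h1, AddChar.one_apply]
  let ρ : Representation ℂ (normOne p ℓ) X := W.comp (normToSubgroup hp h hG)
  have hρ : ∀ (b : normOne p ℓ) (a : RamExt p ℓ) (x : X),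
      T (.ofAdd (((b : (RamExt p ℓ)ˣ) : RamExt p ℓ) * a)) (ρ b x) = ρ b (T (.ofAdd a) x) := fun b a x => by
    rw [hT, hT, mul_smul]
    exact hW.apply_apply (normToSubgroup hp h hG b) (a • u) x
  have hsum := sum_smul_apply_sum_eq_card_smul T ρ hρ hμ hx φ
  have heig := apply_sum_smul_eq_smul ρ φ x
  set y := ∑ b, ((φ b)⁻¹ : ℂˣ).val • ρ b x
  refine (Submodule.ne_bot_iff _).2 ⟨Submodule.Quotient.mk y, fun b => ?_, fun h0 => ?_⟩
  · exact congrArg (Submodule.Quotient.mk (p := botLayer p ℓ S)) (heig b)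
  · rw [Submodule.Quotient.mk_eq_zero] at h0
    have hny : T (.ofAdd n) y = y := by
      refine h0 _ ?_
      rw [toAdd_ofAdd, hn, algebraMap_smul, mul_smul]
      exact Submodule.smul_mem_smul (Ideal.mem_span_singleton_self _) trivial
    -- If `S(0, nu)` fixes `y`, translating the summation variable by `n` shows that the
    -- `μ`-projection of `y`, which is `|A| x`, is multiplied by `μ(n) ≠ 1` without changing. This
    -- is impossible as `x ≠ 0`.
    have hP : μ n • ∑ a, μ (-a) • T (.ofAdd a) y = ∑ a, μ (-a) • T (.ofAdd a) y := by
      rw [Finset.smul_sum]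
      refine Fintype.sum_equiv (Equiv.subRight n) _ _ fun a => ?_
      have h1 : T (.ofAdd a) y = T (.ofAdd (a - n)) y := by
        conv_rhs => rw [← hny]
        rw [← Module.End.mul_apply, ← map_mul, ← ofAdd_add, sub_add_cancel]
      rw [Equiv.subRight_apply, h1, smul_smul, ← AddChar.map_add_eq_mul, neg_sub,
        ← sub_eq_add_neg]
    rw [hsum] at hP
    have h1 : (μ n - 1) • (Fintype.card (RamExt p ℓ) : ℂ) • x = 0 := by
      rw [sub_smul, one_smul, hP, sub_self]
    refine smul_ne_zero (sub_ne_zero.2 hμn) (smul_ne_zero ?_ hx0) h1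
    exact Nat.cast_ne_zero.2 Fintype.card_ne_zero
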